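/- Let $R$ be a firm ring, i.e. an associative ring, not necessarily with unit, such that the multiplication $R\otimes_R R\to R$ is an isomorphism. Let $\mathcal M_R$ be the category of firm right $R$-modules, i.e. those $M$ for which $M\otimes_R R\to M$, $m\otimes r\mapsto mr$, is an isomorphism. Let $A$ be a ring with unit, $\mathfrak C$ an $A$-coring and $\mathcal M^{\mathfrak C}$ the category of right $\mathfrak C$-comodules and right $A$-linear, $\mathfrak C$-colinear maps. Denote the coaction by $\rho(u)=u_{[0]}\otimes_A u_{[1]}$. Let ${}_R\mathcal M^{\mathfrak C}$ be the class of right $\mathfrak C$-comodules $\Sigma$ with a left $R$-module structure that is firm (i.e. $R\otimes_R\Sigma\to\Sigma$ is an isomorphism), commutes with the right $A$-action, and makes the coaction left $R$-linear. For a functor $F:\mathcal M_R\to\mathcal M^{\mathfrak C}$ the following are equivalent: (i) $F$ has a right adjoint; (ii) $F$ is right exact (preserves finite colimits) and preserves all direct sums; (iii) $F\cong-\otimes_R\Sigma$ for some $\Sigma\in{}_R\mathcal M^{\mathfrak C}$. Suppose that these conditions hold. For $r\in R$ let $\lambda_r:R\to R$ be left multiplication by $r$. Then $r\mapsto F(\lambda_r)$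 is a ring morphism $R\to\mathrm{End}^{\mathfrak C}(F(R))$; with the left $R$-action that it defines, $F(R)\in{}_R\mathcal M^{\mathfrak C}$ and $F\cong-\otimes_R F(R)$. Moreover, for every $\Sigma\in{}_R\mathcal M^{\mathfrak C}$ with $F\cong-\otimes_R\Sigma$ (in particular for $\Sigma=F(R)$): (iv) $\mathrm{Hom}^{\mathfrak C}(\Sigma,-)\otimes_R R:\mathcal M^{\mathfrak C}\to\mathcal M_R$ is a right adjoint of $F$, where $R$ acts on $\mathrm{Hom}^{\mathfrak C}(\Sigma,N)$ by $(fr)(u)=f(ru)$, and every right adjoint $G$ of $F$ is isomorphic to it; (v) the left action of $R$ on $\Sigma$ is a ring morphism $\jmath:R\to\mathrm{End}^{\mathfrak C}(\Sigma)$, $\jmath(r)(u)=ru$; (vi) there is a natural transformation of functors from right $A$-modules to right $\mathfrak C$-comodules $$\mathrm{can}_M:\mathrm{Hom}_A(\Sigma,M)\otimes_R\Sigma\to M\otimes_A\mathfrak C,\qquad \mathrm{can}_M(f\otimes_R u)=f(u_{[0]})\otimes_A u_{[1]},$$ where $(fr)(u)=f(ru)$ for $f\in\mathrm{Hom}_A(\Sigma,M)$,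 and the coactions are those induced by $\Sigma$ and by the comultiplication of $\mathfrak C$. -/

import Mathlib

open CategoryTheory CategoryTheory.Limits MulOpposite
open scoped TensorProduct

universe u

namespace FirmCoring

/-! ### Modules over rings that need not have a unit -/

/-- `M` is a left module over the (possibly non-unital) ring `S`.
A right `S`-module is a left module over `Sᵐᵒᵖ`, with `m s` written `op s • m`. -/
class NUModule (S M : Type*) [NonUnitalRing S] [AddCommGroup M] [SMul S M] : Prop where
  smul_add : ∀ (s : S) (m n : M), s • (m + n) = s • m + s • n
  add_smul : ∀ (s t : S) (m : M), (s + t) • m = s • m + t • m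
  mul_smul : ∀ (s t : S) (m : M), (s * t) • m = s • (t • m)

instance (S M : Type*) [Ring S] [AddCommGroup M] [Module S M] : NUModule S M where
  smul_add := _root_.smul_add
  add_smul := _root_.add_smul
  mul_smul := SemigroupAction.mul_smul

instance (R : Type*) [NonUnitalRing R] : NUModule R R where
  smul_add s m n := mul_add s m n
  add_smul s t m := add_mul s t m
  mul_smul s t m := mul_assoc s t m

instance (R : Type*) [NonUnitalRing R] : NUModule Rᵐᵒᵖ R where
  smul_add s m n := add_mul m n s.unop
  add_smul s t m := mul_add m s.unop t.unop
  mul_smul s t m := (mul_assoc m t.unop s.unop).symm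

/-- The action of a scalar as an additive map. -/
def smulHom {S : Type*} (M : Type*) [NonUnitalRing S] [AddCommGroup M] [SMul S M] [NUModule S M]
    (s : S) : M →+ M :=
  AddMonoidHom.mk' (fun m => s • m) (NUModule.smul_add s)

/-! ### The tensor product over a (possibly non-unital, non-commutative) ring -/

section Tens

variable (S : Type*) (M N : Type*) [AddCommGroup M] [AddCommGroup N] [SMul Sᵐᵒᵖ M] [SMul S N]

/-- The relations `m s ⊗ n = m ⊗ s n`. -/
def Tens.rel : Submodule ℤ (M ⊗[ℤ] N) :=
  Submodule.span ℤ
    {t | ∃ (m : M) (s : S) (n : N), t = (op s • m) ⊗ₜ[ℤ] n - m ⊗ₜ[ℤ] (s • n)}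

/-- The tensor product `M ⊗_S N` of a right `S`-module `M` and a left `S`-module `N`, as an
abelian group. -/
def Tens : Type _ := (M ⊗[ℤ] N) ⧸ Tens.rel S M N

instance : AddCommGroup (Tens S M N) := inferInstanceAs (AddCommGroup ((M ⊗[ℤ] N) ⧸ _))

namespace Tens

variable {M N}

/-- The pure tensor `m ⊗_S n`. -/
def tmul (m : M) (n : N) : Tens S M N := Submodule.Quotient.mk (m ⊗ₜ[ℤ] n)

variable {S}

theorem add_tmul (m m' : M) (n : N) : tmul S (m + m') n = tmul S m n + tmul S m' n := by
  unfold tmul; rw [TensorProduct.add_tmul]; rfl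

theorem tmul_add (m : M) (n n' : N) : tmul S m (n + n') = tmul S m n + tmul S m n' := by
  unfold tmul; rw [TensorProduct.tmul_add]; rfl

theorem smul_tmul (s : S) (m : M) (n : N) : tmul S (op s • m) n = tmul S m (s • n) :=
  (Submodule.Quotient.eq _).2 (Submodule.subset_span ⟨m, s, n, rfl⟩)

/-- The additive map out of `M ⊗_S N` induced by a balanced biadditive map. -/
def lift {P : Type*} [AddCommGroup P] (f : M →+ N →+ P)
    (hf : ∀ (s : S) m n, f (op s • m) n = f m (s • n)) : Tens S M N →+ P :=
  ((rel S M N).liftQ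
    (TensorProduct.liftAddHom f (by intro r m n; simp)).toIntLinearMap (by
      rw [rel, Submodule.span_le]
      rintro _ ⟨m, s, n, rfl⟩
      simp [hf])).toAddMonoidHom

@[simp] theorem lift_tmul {P : Type*} [AddCommGroup P] (f : M →+ N →+ P)
    (hf : ∀ (s : S) m n, f (op s • m) n = f m (s • n)) (m : M) (n : N) :
    lift f hf (tmul S m n) = f m n := rfl

theorem hom_ext {P : Type*} [AddCommGroup P] {f g : Tens S M N →+ P}
    (h : ∀ m n, f (tmul S m n) = g (tmul S m n)) : f = g := by
  ext x
  obtain ⟨x, rfl⟩ := Submodule.Quotient.mk_surjective _ x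
  induction x with
  | zero => exact (map_zero f).trans (map_zero g).symm
  | tmul m n => exact h m n
  | add x y hx hy =>
    rw [Submodule.Quotient.mk_add]
    exact (map_add f _ _).trans ((congrArg₂ (· + ·) hx hy).trans (map_add g _ _).symm)

theorem hom_congr {P : Type*} [AddCommGroup P] {f g : Tens S M N →+ P}
    (h : ∀ m n, f (tmul S m n) = g (tmul S m n)) (x : Tens S M N) : f x = g x :=
  DFunLike.congr_fun (hom_ext h) x

variable (S) in
/-- Pure tensors as a biadditive map. -/
def mk : M →+ N →+ Tens S M N :=
  AddMonoidHom.mk' (fun m => AddMonoidHom.mk' (tmul S m) (tmul_add m))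
    (fun m m' => by ext n; exact add_tmul m m' n)

@[simp] theorem mk_apply (m : M) (n : N) : mk S m n = tmul S m n := rfl

/-- The map `f ⊗_S g`. -/
def map {M' N' : Type*} [AddCommGroup M'] [AddCommGroup N'] [SMul Sᵐᵒᵖ M'] [SMul S N']
    (f : M →+ M') (hf : ∀ (s : S) m, f (op s • m) = op s • f m)
    (g : N →+ N') (hg : ∀ (s : S) n, g (s • n) = s • g n) : Tens S M N →+ Tens S M' N' :=
  lift (((mk S).comp f).compr₂ (AddMonoidHom.id _) |>.compl₂ g) (by
    intro s m n
    change tmul S (f (op s • m)) (g n) = tmul S (f m) (g (s • n))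
    rw [hf, hg, smul_tmul])

@[simp] theorem map_tmul {M' N' : Type*} [AddCommGroup M'] [AddCommGroup N'] [SMul Sᵐᵒᵖ M']
    [SMul S N'] (f : M →+ M') (hf : ∀ (s : S) m, f (op s • m) = op s • f m)
    (g : N →+ N') (hg : ∀ (s : S) n, g (s • n) = s • g n) (m : M) (n : N) :
    map f hf g hg (tmul S m n) = tmul S (f m) (g n) := rfl

end Tens

end Tens

namespace Tens

section Actions

variable {S T : Type*} {M N : Type*} [AddCommGroup M] [AddCommGroup N] [SMul Sᵐᵒᵖ M] [SMul S N]
  [NonUnitalRing T]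

/-- If `M` is a `T`-`S`-bimodule, then `M ⊗_S N` is a left `T`-module: `t (m ⊗ n) = t m ⊗ n`. -/
instance [SMul T M] [NUModule T M] [SMulCommClass T Sᵐᵒᵖ M] : SMul T (Tens S M N) where
  smul t := map (smulHom M t) (fun s m => smul_comm t (op s) m) (AddMonoidHom.id N)
    (fun _ _ => rfl)

/-- If `N` is an `S`-`T`-bimodule, then `M ⊗_S N` is a right `T`-module: `(m ⊗ n) t = m ⊗ n t`. -/
instance [SMul Tᵐᵒᵖ N] [NUModule Tᵐᵒᵖ N] [SMulCommClass S Tᵐᵒᵖ N] :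
    SMul Tᵐᵒᵖ (Tens S M N) where
  smul t := map (AddMonoidHom.id M) (fun _ _ => rfl) (smulHom N t)
    (fun s n => (smul_comm s t n).symm)

theorem smul_tmul_left [SMul T M] [NUModule T M] [SMulCommClass T Sᵐᵒᵖ M]
    (t : T) (m : M) (n : N) : t • tmul S m n = tmul S (t • m) n := rfl

theorem op_smul_tmul [SMul Tᵐᵒᵖ N] [NUModule Tᵐᵒᵖ N] [SMulCommClass S Tᵐᵒᵖ N]
    (t : Tᵐᵒᵖ) (m : M) (n : N) : t • tmul S m n = tmul S m (t • n) := rfl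

instance [SMul Tᵐᵒᵖ N] [NUModule Tᵐᵒᵖ N] [SMulCommClass S Tᵐᵒᵖ N] :
    NUModule Tᵐᵒᵖ (Tens S M N) where
  smul_add t x y := map_add (map (AddMonoidHom.id M) (fun _ _ => rfl) (smulHom N t)
    (fun s n => (smul_comm s t n).symm)) x y
  add_smul t t' x := by
    refine hom_congr (f := map (AddMonoidHom.id M) (fun _ _ => rfl) (smulHom N (t + t')) _)
      (g := map (AddMonoidHom.id M) (fun _ _ => rfl) (smulHom N t) _ +
        map (AddMonoidHom.id M) (fun _ _ => rfl) (smulHom N t') _) (fun m n => ?_) x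
    change tmul S m ((t + t') • n) = tmul S m (t • n) + tmul S m (t' • n)
    rw [NUModule.add_smul, tmul_add]
  mul_smul t t' x := by
    refine hom_congr (f := map (AddMonoidHom.id M) (fun _ _ => rfl) (smulHom N (t * t')) _)
      (g := (map (AddMonoidHom.id M) (fun _ _ => rfl) (smulHom N t)
        (fun s n => (smul_comm s t n).symm)).comp
        (map (AddMonoidHom.id M) (fun _ _ => rfl) (smulHom N t')
          (fun s n => (smul_comm s t' n).symm))) (fun m n => ?_) x
    change tmul S m ((t * t') • n) = tmul S m (t • (t' • n))
    rw [NUModule.mul_smul]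

/-- Over a unital ring `A`, the right action on `M ⊗_S N` is unital. -/
instance {A : Type*} [Ring A] [Module Aᵐᵒᵖ N] [SMulCommClass S Aᵐᵒᵖ N] :
    Module Aᵐᵒᵖ (Tens S M N) where
  smul t x := t • x
  smul_add := NUModule.smul_add
  add_smul := NUModule.add_smul
  mul_smul := NUModule.mul_smul
  one_smul x := by
    refine hom_congr (f := map (AddMonoidHom.id M) (fun _ _ => rfl) (smulHom N (1 : Aᵐᵒᵖ)) _)
      (g := AddMonoidHom.id _) (fun m n => ?_) x
    change tmul S m ((1 : Aᵐᵒᵖ) • n) = tmul S m n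
    rw [one_smul]
  smul_zero t := map_zero (map (AddMonoidHom.id M) (fun _ _ => rfl) (smulHom N t)
    (fun s n => (smul_comm s t n).symm))
  zero_smul x := by
    refine hom_congr (f := map (AddMonoidHom.id M) (fun _ _ => rfl) (smulHom N (0 : Aᵐᵒᵖ)) _)
      (g := 0) (fun m n => ?_) x
    change tmul S m ((0 : Aᵐᵒᵖ) • n) = 0
    rw [zero_smul]
    exact map_zero (mk S m)

end Actions

/-- The canonical map `M ⊗_S (N ⊗_T P) → (M ⊗_S N) ⊗_T P`, `m ⊗ (n ⊗ p) ↦ (m ⊗ n) ⊗ p`. -/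
def assoc (S T M N P : Type*) [NonUnitalRing S] [NonUnitalRing T] [AddCommGroup M]
    [AddCommGroup N] [AddCommGroup P] [SMul Sᵐᵒᵖ M] [SMul S N] [NUModule S N] [SMul Tᵐᵒᵖ N]
    [NUModule Tᵐᵒᵖ N] [SMulCommClass S Tᵐᵒᵖ N] [SMul T P] :
    Tens S M (Tens T N P) →+ Tens T (Tens S M N) P :=
  lift
    (AddMonoidHom.mk' (fun m => map (mk S m) (fun t n => (op_smul_tmul (op t) m n).symm)
        (AddMonoidHom.id P) (fun _ _ => rfl))
      (fun m m' => hom_ext (fun n p => by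
        change tmul T (tmul S (m + m') n) p = tmul T (tmul S m n) p + tmul T (tmul S m' n) p
        rw [add_tmul, add_tmul])))
    (fun s m x => by
      refine hom_congr
        (f := map (mk S (op s • m)) (fun t n => (op_smul_tmul (op t) (op s • m) n).symm)
          (AddMonoidHom.id P) (fun _ _ => rfl))
        (g := (map (mk S m) (fun t n => (op_smul_tmul (op t) m n).symm)
          (AddMonoidHom.id P) (fun _ _ => rfl)).comp
          (map (smulHom N s) (fun t n => smul_comm s (op t) n) (AddMonoidHom.id P)
            (fun _ _ => rfl))) (fun n p => ?_) x
      change tmul T (tmul S (op s • m) n) p = tmul T (tmul S m (s • n)) p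
      rw [smul_tmul])

@[simp] theorem assoc_tmul {S T M N P : Type*} [NonUnitalRing S] [NonUnitalRing T]
    [AddCommGroup M]
    [AddCommGroup N] [AddCommGroup P] [SMul Sᵐᵒᵖ M] [SMul S N] [NUModule S N] [SMul Tᵐᵒᵖ N]
    [NUModule Tᵐᵒᵖ N] [SMulCommClass S Tᵐᵒᵖ N] [SMul T P] (m : M) (n : N) (p : P) :
    assoc S T M N P (tmul S m (tmul T n p)) = tmul T (tmul S m n) p := rfl

/-- For a left linear map `e : N → S`, the map `M ⊗_S N → M`, `m ⊗ n ↦ m e(n)`; that is, `M ⊗ e`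
followed by the multiplication `M ⊗_S S → M`. -/
def evalRight {S M N : Type*} [NonUnitalRing S] [AddCommGroup M] [AddCommGroup N]
    [SMul Sᵐᵒᵖ M] [NUModule Sᵐᵒᵖ M] [SMul S N] (e : N →+ S)
    (he : ∀ (s : S) n, e (s • n) = s * e n) : Tens S M N →+ M :=
  lift (AddMonoidHom.mk' (fun m => AddMonoidHom.mk' (fun n => op (e n) • m)
      (fun n n' => by rw [map_add]; exact NUModule.add_smul (op (e n)) (op (e n')) m))
      (fun m m' => by ext n; exact NUModule.smul_add _ _ _))
    (fun s m n => by
      change op (e n) • (op s • m) = op (e (s • n)) • m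
      rw [he, op_mul, NUModule.mul_smul])

/-- For a right linear map `e : M → S`, the map `M ⊗_S N → N`, `m ⊗ n ↦ e(m) n`; that is, `e ⊗ N`
followed by the multiplication `S ⊗_S N → N`. -/
def evalLeft {S M N : Type*} [NonUnitalRing S] [AddCommGroup M] [AddCommGroup N]
    [SMul Sᵐᵒᵖ M] [SMul S N] [NUModule S N] (e : M →+ S)
    (he : ∀ (s : S) m, e (op s • m) = e m * s) : Tens S M N →+ N :=
  lift (AddMonoidHom.mk' (fun m => AddMonoidHom.mk' (fun n => e m • n)
      (fun n n' => NUModule.smul_add _ _ _))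
      (fun m m' => by
        ext n
        change e (m + m') • n = e m • n + e m' • n
        rw [map_add, NUModule.add_smul]))
    (fun s m n => by
      change e (op s • m) • n = e m • (s • n)
      rw [he, NUModule.mul_smul])

end Tens

/-! ### Firm modules and firm rings -/

/-- The multiplication map `M ⊗_R R → M`, `m ⊗ r ↦ m r`. -/
def mulRight (R M : Type*) [NonUnitalRing R] [AddCommGroup M] [SMul Rᵐᵒᵖ M] [NUModule Rᵐᵒᵖ M] :
    Tens R M R →+ M :=
  Tens.evalRight (AddMonoidHom.id R) (fun _ _ => rfl)

/-- The multiplication map `R ⊗_R M → M`, `r ⊗ m ↦ r m`. -/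
def mulLeft (R M : Type*) [NonUnitalRing R] [AddCommGroup M] [SMul R M] [NUModule R M] :
    Tens R R M →+ M :=
  Tens.evalLeft (AddMonoidHom.id R) (fun _ _ => rfl)

/-- `R` is a firm ring: multiplication `R ⊗_R R → R` is an isomorphism. -/
class IsFirmRing (R : Type*) [NonUnitalRing R] : Prop where
  bijective : Function.Bijective (mulRight R R)

/-- Right modules over the non-unital ring `R`, not necessarily firm. -/
structure RMod (R : Type u) [NonUnitalRing R] : Type (u + 1) where
  carrier : Type u
  [addCommGroup : AddCommGroup carrier]
  [smul : SMul Rᵐᵒᵖ carrier]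
  [nuModule : NUModule Rᵐᵒᵖ carrier]

attribute [instance] RMod.addCommGroup RMod.smul RMod.nuModule

namespace RMod

variable {R : Type u} [NonUnitalRing R]

/-- Right `R`-linear maps. -/
@[ext] structure Hom (M N : RMod R) : Type u where
  toAddHom : M.carrier →+ N.carrier
  map_op_smul : ∀ (r : R) (m : M.carrier), toAddHom (op r • m) = op r • toAddHom m

instance : Category (RMod R) where
  Hom := Hom
  id M := ⟨AddMonoidHom.id _, fun _ _ => rfl⟩
  comp f g := ⟨g.toAddHom.comp f.toAddHom, fun r m => by
    simp [f.map_op_smul, g.map_op_smul]⟩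

/-- A right module is firm if multiplication `M ⊗_R R → M` is an isomorphism. -/
def isFirm (R : Type u) [NonUnitalRing R] : ObjectProperty (RMod R) :=
  fun M => Function.Bijective (mulRight R M.carrier)

end RMod

/-- The category of firm right `R`-modules and right `R`-linear maps. -/
abbrev FirmMod (R : Type u) [NonUnitalRing R] := (RMod.isFirm R).FullSubcategory

/-- The firm ring `R` as an object of the category of firm right `R`-modules. -/
def FirmMod.self (R : Type u) [NonUnitalRing R] [IsFirmRing R] : FirmMod R :=
  ⟨⟨R⟩, IsFirmRing.bijective⟩

/-- Left multiplication by `r`, as an endomorphism of the right module `R`. -/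
def FirmMod.lmul (R : Type u) [NonUnitalRing R] [IsFirmRing R] (r : R) :
    FirmMod.self R ⟶ FirmMod.self R :=
  ObjectProperty.homMk
    (show RMod.Hom ⟨R⟩ ⟨R⟩ from ⟨AddMonoidHom.mulLeft r, fun s m => (mul_assoc r m s).symm⟩)

/-- For a firm ring `R` and a right `R`-module `X`, the module `X ⊗_R R` is firm. -/
theorem isFirm_tensor (R : Type u) [NonUnitalRing R] [IsFirmRing R] (X : RMod R) :
    RMod.isFirm R ⟨Tens R X.carrier R⟩ := by
  have hlin : ∀ (s : R) (y : Tens R R R), mulRight R R (s • y) = s • mulRight R R y :=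
    fun s y => Tens.hom_congr
      (f := (mulRight R R).comp (Tens.map (smulHom R s) (fun t n => smul_comm s (op t) n)
        (AddMonoidHom.id R) (fun _ _ => rfl)))
      (g := (smulHom R s).comp (mulRight R R)) (fun a b => mul_assoc s a b) y
  let e : Tens R R R ≃+ R := AddEquiv.ofBijective (mulRight R R) IsFirmRing.bijective
  have he : ∀ y, e y = mulRight R R y := fun _ => rfl
  have hd : ∀ (s r : R), e.symm.toAddMonoidHom (s • r) = s • e.symm.toAddMonoidHom r := by
    intro s r
    apply e.injective
    change e (e.symm (s • r)) = mulRight R R (s • e.symm r)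
    rw [hlin, ← he, e.apply_symm_apply, e.apply_symm_apply]
  let g : Tens R X.carrier R →+ Tens R (Tens R X.carrier R) R :=
    (Tens.assoc R R X.carrier R R).comp
      (Tens.map (AddMonoidHom.id X.carrier) (fun _ _ => rfl) e.symm.toAddMonoidHom hd)
  have hcomp : ∀ (x : X.carrier) (y : Tens R R R), mulRight R (Tens R X.carrier R)
      (Tens.assoc R R X.carrier R R (Tens.tmul R x y)) = Tens.tmul R x (mulRight R R y) :=
    fun x y => Tens.hom_congr (f := ((mulRight R (Tens R X.carrier R)).comp
      (Tens.assoc R R X.carrier R R)).comp (Tens.mk R x))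
      (g := (Tens.mk R x).comp (mulRight R R)) (fun a b => rfl) y
  refine Function.bijective_iff_has_inverse.2 ⟨g, fun z => ?_, fun z => ?_⟩
  · refine Tens.hom_congr (f := g.comp (mulRight R (Tens R X.carrier R)))
      (g := AddMonoidHom.id _) (fun w s => ?_) z
    refine Tens.hom_congr
      (f := (g.comp (mulRight R (Tens R X.carrier R))).comp ((Tens.mk R).flip s))
      (g := (Tens.mk R).flip s) (fun x r => ?_) w
    change Tens.assoc R R X.carrier R R (Tens.tmul R x (e.symm (e (Tens.tmul R r s)))) = _
    rw [e.symm_apply_apply]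
    rfl
  · refine Tens.hom_congr (f := (mulRight R (Tens R X.carrier R)).comp g)
      (g := AddMonoidHom.id _) (fun x r => ?_) z
    change mulRight R (Tens R X.carrier R)
      (Tens.assoc R R X.carrier R R (Tens.tmul R x (e.symm r))) = Tens.tmul R x r
    rw [hcomp, ← he, e.apply_symm_apply]

/-- The functor `- ⊗_R R` from right `R`-modules to firm right `R`-modules. -/
def firmification (R : Type u) [NonUnitalRing R] [IsFirmRing R] : RMod R ⥤ FirmMod R where
  obj X := ⟨⟨Tens R X.carrier R⟩, isFirm_tensor R X⟩
  map {X Y} f := ObjectProperty.homMk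
    (show RMod.Hom ⟨Tens R X.carrier R⟩ ⟨Tens R Y.carrier R⟩ from
      ⟨Tens.map f.toAddHom f.map_op_smul (AddMonoidHom.id R) (fun _ _ => rfl),
        fun r x => Tens.hom_congr
          (f := (Tens.map f.toAddHom f.map_op_smul (AddMonoidHom.id R) (fun _ _ => rfl)).comp
            (smulHom (Tens R X.carrier R) (op r)))
          (g := (smulHom (Tens R Y.carrier R) (op r)).comp
            (Tens.map f.toAddHom f.map_op_smul (AddMonoidHom.id R) (fun _ _ => rfl)))
          (fun _ _ => rfl) x⟩)
  map_id X := by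
    apply ObjectProperty.hom_ext
    exact RMod.Hom.ext (Tens.hom_ext fun _ _ => rfl)
  map_comp f g := by
    apply ObjectProperty.hom_ext
    exact RMod.Hom.ext (Tens.hom_ext fun _ _ => rfl)

/-! ### Corings and comodules -/

/-- An `A`-coring structure on the `A`-bimodule `C`. -/
class Coring (A : Type u) [Ring A] (C : Type u) [AddCommGroup C] [Module A C] [Module Aᵐᵒᵖ C]
    [SMulCommClass A Aᵐᵒᵖ C] where
  comul : C →+ Tens A C C
  comul_smul : ∀ (a : A) (c : C), comul (a • c) = a • comul c
  comul_op_smul : ∀ (a : A) (c : C), comul (op a • c) = op a • comul c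
  counit : C →+ A
  counit_smul : ∀ (a : A) (c : C), counit (a • c) = a * counit c
  counit_op_smul : ∀ (a : A) (c : C), counit (op a • c) = counit c * a
  coassoc : ∀ c : C,
    Tens.assoc A A C C C (Tens.map (AddMonoidHom.id C) (fun _ _ => rfl) comul comul_smul (comul c))
      = Tens.map comul comul_op_smul (AddMonoidHom.id C) (fun _ _ => rfl) (comul c)
  counit_left : ∀ c : C, Tens.evalLeft counit counit_op_smul (comul c) = c
  counit_right : ∀ c : C, Tens.evalRight counit counit_smul (comul c) = c

section Comodules

variable (A : Type u) [Ring A] (C : Type u) [AddCommGroup C] [Module A C] [Module Aᵐᵒᵖ C]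
  [SMulCommClass A Aᵐᵒᵖ C]

/-- The map `f ⊗_A C` for a right `A`-linear map `f`. -/
def tensorCoring {A : Type u} [Ring A] (C : Type u) [AddCommGroup C] [Module A C]
    {M N : Type u} [AddCommGroup M] [AddCommGroup N]
    [Module Aᵐᵒᵖ M] [Module Aᵐᵒᵖ N] (f : M →ₗ[Aᵐᵒᵖ] N) : Tens A M C →+ Tens A N C :=
  Tens.map f.toAddMonoidHom (fun a m => f.map_smul (op a) m) (AddMonoidHom.id C) (fun _ _ => rfl)

theorem tensorCoring_comp {A : Type u} [Ring A] {C : Type u} [AddCommGroup C] [Module A C]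
    {M N P : Type u} [AddCommGroup M] [AddCommGroup N] [AddCommGroup P]
    [Module Aᵐᵒᵖ M] [Module Aᵐᵒᵖ N] [Module Aᵐᵒᵖ P] (g : N →ₗ[Aᵐᵒᵖ] P) (f : M →ₗ[Aᵐᵒᵖ] N)
    (x : Tens A M C) : tensorCoring C (g ∘ₗ f) x = tensorCoring C g (tensorCoring C f x) :=
  Tens.hom_congr (f := tensorCoring C (g ∘ₗ f)) (g := (tensorCoring C g).comp (tensorCoring C f))
    (fun _ _ => rfl) x

theorem tensorCoring_smul {A : Type u} [Ring A] {C : Type u} [AddCommGroup C] [Module A C]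
    [Module Aᵐᵒᵖ C] [SMulCommClass A Aᵐᵒᵖ C] {M N : Type u} [AddCommGroup M] [AddCommGroup N]
    [Module Aᵐᵒᵖ M] [Module Aᵐᵒᵖ N] (f : M →ₗ[Aᵐᵒᵖ] N) (a : Aᵐᵒᵖ) (x : Tens A M C) :
    tensorCoring C f (a • x) = a • tensorCoring C f x :=
  Tens.hom_congr (f := (tensorCoring C f).comp (smulHom _ a))
    (g := (smulHom _ a).comp (tensorCoring C f)) (fun _ _ => rfl) x

/-- The map `f ⊗_A C`, as a right `A`-linear map. -/
def tensorCoringLin {A : Type u} [Ring A] (C : Type u) [AddCommGroup C] [Module A C]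
    [Module Aᵐᵒᵖ C] [SMulCommClass A Aᵐᵒᵖ C] {M N : Type u} [AddCommGroup M] [AddCommGroup N]
    [Module Aᵐᵒᵖ M] [Module Aᵐᵒᵖ N] (f : M →ₗ[Aᵐᵒᵖ] N) : Tens A M C →ₗ[Aᵐᵒᵖ] Tens A N C where
  toFun := tensorCoring C f
  map_add' := map_add _
  map_smul' := tensorCoring_smul f

variable [Coring A C]

theorem coassoc_tensorCoring {A : Type u} [Ring A] {C : Type u} [AddCommGroup C] [Module A C]
    [Module Aᵐᵒᵖ C] [SMulCommClass A Aᵐᵒᵖ C] [Coring A C] {M N : Type u} [AddCommGroup M]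
    [AddCommGroup N] [Module Aᵐᵒᵖ M] [Module Aᵐᵒᵖ N] (f : M →ₗ[Aᵐᵒᵖ] N) (x : Tens A M C) :
    Tens.assoc A A N C C (Tens.map (AddMonoidHom.id N) (fun _ _ => rfl)
        Coring.comul Coring.comul_smul (tensorCoring C f x))
      = tensorCoring C (tensorCoringLin C f) (Tens.assoc A A M C C
        (Tens.map (AddMonoidHom.id M) (fun _ _ => rfl) Coring.comul Coring.comul_smul x)) := by
  refine Tens.hom_congr
    (f := ((Tens.assoc A A N C C).comp (Tens.map (AddMonoidHom.id N) (fun _ _ => rfl)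
      Coring.comul Coring.comul_smul)).comp (tensorCoring C f))
    (g := (tensorCoring C (tensorCoringLin C f)).comp ((Tens.assoc A A M C C).comp
        (Tens.map (AddMonoidHom.id M) (fun _ _ => rfl) Coring.comul Coring.comul_smul)))
    (fun m c => ?_) x
  exact Tens.hom_congr
    (f := (Tens.assoc A A N C C).comp (Tens.mk A (f m)))
    (g := (tensorCoring C (tensorCoringLin C f)).comp ((Tens.assoc A A M C C).comp
      (Tens.mk A m))) (fun _ _ => rfl) (Coring.comul c)

/-- Right `C`-comodules: right `A`-modules `M` with a right `A`-linear, coassociative and counital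
coaction `M → M ⊗_A C`. -/
structure Comod : Type (u + 1) where
  carrier : Type u
  [addCommGroup : AddCommGroup carrier]
  [module : Module Aᵐᵒᵖ carrier]
  coact : carrier →ₗ[Aᵐᵒᵖ] Tens A carrier C
  coassoc : ∀ m : carrier,
    Tens.assoc A A carrier C C (Tens.map (AddMonoidHom.id carrier) (fun _ _ => rfl)
        Coring.comul Coring.comul_smul (coact m))
      = Tens.map coact.toAddMonoidHom (fun a m => coact.map_smul (op a) m)
        (AddMonoidHom.id C) (fun _ _ => rfl) (coact m)
  counit : ∀ m : carrier, Tens.evalRight Coring.counit Coring.counit_smul (coact m) = m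

attribute [instance] Comod.addCommGroup Comod.module

variable {A C}

namespace Comod

/-- The group `Hom^C(M, N)` of right `C`-colinear maps. -/
def colinear (M N : Comod A C) : AddSubgroup (M.carrier →ₗ[Aᵐᵒᵖ] N.carrier) where
  carrier := {f | ∀ m, N.coact (f m) = tensorCoring C f (M.coact m)}
  zero_mem' m := by
    change N.coact 0 = _
    rw [map_zero]
    refine (Tens.hom_congr (f := tensorCoring C (0 : M.carrier →ₗ[Aᵐᵒᵖ] N.carrier)) (g := 0)
      (fun m c => ?_) (M.coact m)).symm
    exact map_zero ((Tens.mk A).flip c)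
  add_mem' {f g} hf hg m := by
    change N.coact (f m + g m) = _
    rw [map_add, hf m, hg m]
    refine (Tens.hom_congr (f := tensorCoring C (f + g))
      (g := tensorCoring C f + tensorCoring C g) (fun m c => ?_) (M.coact m)).symm
    exact Tens.add_tmul (f m) (g m) c
  neg_mem' {f} hf m := by
    change N.coact (- f m) = _
    rw [map_neg, hf m]
    refine (Tens.hom_congr (f := tensorCoring C (-f))
      (g := - tensorCoring C f) (fun m c => ?_) (M.coact m)).symm
    exact map_neg ((Tens.mk A).flip c) (f m)

/-- The category of right `C`-comodules and colinear maps. -/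
instance : Category (Comod A C) where
  Hom M N := colinear M N
  id M := ⟨LinearMap.id, fun m =>
    (Tens.hom_congr (f := tensorCoring C (LinearMap.id : M.carrier →ₗ[Aᵐᵒᵖ] M.carrier))
      (g := AddMonoidHom.id _) (fun _ _ => rfl) (M.coact m)).symm⟩
  comp {M N P} f g := ⟨g.1 ∘ₗ f.1, fun m => by
    rw [tensorCoring_comp, ← f.2 m, ← g.2 (f.1 m)]; rfl⟩

instance : Preadditive (Comod A C) where
  homGroup M N := inferInstanceAs (AddCommGroup (colinear M N))
  add_comp _ _ _ f f' g := Subtype.ext (LinearMap.ext fun m => map_add g.1 (f.1 m) (f'.1 m))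
  comp_add _ _ _ _ _ _ := rfl

end Comod

end Comodules

/-! ### Bicomodules and the functors attached to them -/

section Bicomodules

variable (R : Type u) [NonUnitalRing R]
variable (A : Type u) [Ring A] (C : Type u) [AddCommGroup C] [Module A C] [Module Aᵐᵒᵖ C]
  [SMulCommClass A Aᵐᵒᵖ C] [Coring A C]

/-- Right `C`-comodules with a left `R`-module structure that commutes with the right `A`-action
and for which the coaction is left `R`-linear. -/
structure Bicomod extends Comod A C where
  [smul : SMul R carrier]
  [nuModule : NUModule R carrier]
  [smulComm : SMulCommClass R Aᵐᵒᵖ carrier]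
  coact_smul : ∀ (r : R) (m : carrier), coact (r • m) = r • coact m

attribute [instance] Bicomod.smul Bicomod.nuModule Bicomod.smulComm

variable {R A C}

namespace Bicomod

/-- The left `R`-module `Σ` is firm: multiplication `R ⊗_R Σ → Σ` is an isomorphism. Objects of
the category of `R`-`C`-bicomodules over a firm ring `R` are required to be firm. -/
def IsFirm (B : Bicomod R A C) : Prop := Function.Bijective (mulLeft R B.carrier)

/-- Left multiplication by `r` is colinear. -/
def lmul (B : Bicomod R A C) (r : R) : B.toComod ⟶ B.toComod :=
  ⟨{ toFun := fun m => r • m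
     map_add' := NUModule.smul_add r
     map_smul' := fun a m => smul_comm r a m }, fun m => B.coact_smul r m⟩

/-- A ring morphism `R → End^C(X)` turns the comodule `X` into an `R`-`C`-bicomodule. -/
def ofHom (X : Comod A C) (j : R →ₙ+* End X) : Bicomod R A C :=
  letI : SMul R X.carrier := ⟨fun r m => (j r).1 m⟩
  haveI : NUModule R X.carrier :=
    { smul_add := fun r m n => map_add (j r).1 m n
      add_smul := fun r s m => by
        change (j (r + s)).1 m = _
        rw [map_add]; rfl
      mul_smul := fun r s m => by
        change (j (r * s)).1 m = _
        rw [map_mul]; rfl }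
  haveI : SMulCommClass R Aᵐᵒᵖ X.carrier := ⟨fun r a m => (j r).1.map_smul a m⟩
  { X with
    coact_smul := fun r m => (j r).2 m }

/-- The map `u ↦ m ⊗ u`. -/
def pureTensor (B : Bicomod R A C) (M : RMod R) (m : M.carrier) :
    B.carrier →ₗ[Aᵐᵒᵖ] Tens R M.carrier B.carrier where
  toFun := Tens.tmul R m
  map_add' := Tens.tmul_add m
  map_smul' a u := (Tens.op_smul_tmul a m u).symm

/-- The coaction of `M ⊗_R Σ`: the map `M ⊗_R ρ` followed by the canonical map
`M ⊗_R (Σ ⊗_A C) → (M ⊗_R Σ) ⊗_A C`. -/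
def tensorCoact (B : Bicomod R A C) (M : RMod R) :
    Tens R M.carrier B.carrier →+ Tens A (Tens R M.carrier B.carrier) C :=
  (Tens.assoc R A M.carrier B.carrier C).comp
    (Tens.map (AddMonoidHom.id M.carrier) (fun _ _ => rfl)
      B.coact.toAddMonoidHom B.coact_smul)

theorem tensorCoact_tmul (B : Bicomod R A C) (M : RMod R) (m : M.carrier) (u : B.carrier) :
    B.tensorCoact M (Tens.tmul R m u) = tensorCoring C (B.pureTensor M m) (B.coact u) := rfl

/-- The coaction of `M ⊗_R Σ`, as a right `A`-linear map. -/
def tensorCoactLin (B : Bicomod R A C) (M : RMod R) :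
    Tens R M.carrier B.carrier →ₗ[Aᵐᵒᵖ] Tens A (Tens R M.carrier B.carrier) C where
  toFun := B.tensorCoact M
  map_add' := map_add _
  map_smul' a x := by
    refine Tens.hom_congr (f := (B.tensorCoact M).comp (smulHom _ a))
      (g := (smulHom (Tens A (Tens R M.carrier B.carrier) C) a).comp (B.tensorCoact M))
      (fun m u => ?_) x
    change tensorCoring C (B.pureTensor M m) (B.coact (a • u))
      = a • tensorCoring C (B.pureTensor M m) (B.coact u)
    rw [map_smul, tensorCoring_smul]

theorem tensorCoact_pure (B : Bicomod R A C) (M : RMod R) (m : M.carrier) (y : Tens A B.carrier C) :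
    tensorCoring C (B.tensorCoactLin M) (tensorCoring C (B.pureTensor M m) y)
      = tensorCoring C (tensorCoringLin C (B.pureTensor M m)) (tensorCoring C B.coact y) :=
  Tens.hom_congr
    (f := (tensorCoring C (B.tensorCoactLin M)).comp (tensorCoring C (B.pureTensor M m)))
    (g := (tensorCoring C (tensorCoringLin C (B.pureTensor M m))).comp (tensorCoring C B.coact))
    (fun _ _ => rfl) y

theorem tensor_coassoc (B : Bicomod R A C) (M : RMod R) (x : Tens R M.carrier B.carrier) :
    Tens.assoc A A (Tens R M.carrier B.carrier) C C
        (Tens.map (AddMonoidHom.id (Tens R M.carrier B.carrier)) (fun _ _ => rfl)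
          Coring.comul Coring.comul_smul (B.tensorCoact M x))
      = tensorCoring C (B.tensorCoactLin M) (B.tensorCoact M x) := by
  refine Tens.hom_congr
    (f := ((Tens.assoc A A (Tens R M.carrier B.carrier) C C).comp
      (Tens.map (AddMonoidHom.id (Tens R M.carrier B.carrier)) (fun _ _ => rfl)
        Coring.comul Coring.comul_smul)).comp (B.tensorCoact M))
    (g := (tensorCoring C (B.tensorCoactLin M)).comp (B.tensorCoact M)) (fun m u => ?_) x
  refine (coassoc_tensorCoring (B.pureTensor M m) (B.coact u)).trans ?_
  rw [B.coassoc u]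
  exact (B.tensorCoact_pure M m (B.coact u)).symm

theorem counit_pure (B : Bicomod R A C) (M : RMod R) (m : M.carrier) (y : Tens A B.carrier C) :
    Tens.evalRight Coring.counit Coring.counit_smul (tensorCoring C (B.pureTensor M m) y)
      = B.pureTensor M m (Tens.evalRight Coring.counit Coring.counit_smul y) :=
  Tens.hom_congr
    (f := (Tens.evalRight Coring.counit Coring.counit_smul).comp
      (tensorCoring C (B.pureTensor M m)))
    (g := (B.pureTensor M m).toAddMonoidHom.comp
      (Tens.evalRight Coring.counit Coring.counit_smul))
    (fun u c => (map_smul (B.pureTensor M m) (op (Coring.counit c)) u).symm) y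

theorem tensor_counit (B : Bicomod R A C) (M : RMod R) (x : Tens R M.carrier B.carrier) :
    Tens.evalRight Coring.counit Coring.counit_smul (B.tensorCoact M x) = x := by
  have h : (Tens.evalRight (Coring.counit : C →+ A) Coring.counit_smul).comp (B.tensorCoact M)
      = AddMonoidHom.id (Tens R M.carrier B.carrier) := Tens.hom_ext (fun m u => by
    rw [AddMonoidHom.comp_apply, tensorCoact_tmul, counit_pure, B.counit u]
    rfl)
  exact DFunLike.congr_fun h x

/-- The right `C`-comodule `M ⊗_R Σ`. -/
def tensorObj (B : Bicomod R A C) (M : RMod R) : Comod A C where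
  carrier := Tens R M.carrier B.carrier
  coact := B.tensorCoactLin M
  coassoc := B.tensor_coassoc M
  counit := B.tensor_counit M

/-- The map `f ⊗_R Σ`. -/
def tensorMap (B : Bicomod R A C) {M N : RMod R} (f : M ⟶ N) :
    Tens R M.carrier B.carrier →ₗ[Aᵐᵒᵖ] Tens R N.carrier B.carrier where
  toFun := Tens.map f.toAddHom f.map_op_smul (AddMonoidHom.id B.carrier) (fun _ _ => rfl)
  map_add' := map_add _
  map_smul' a x := Tens.hom_congr
    (f := (Tens.map f.toAddHom f.map_op_smul (AddMonoidHom.id B.carrier)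
      (fun _ _ => rfl)).comp (smulHom (Tens R M.carrier B.carrier) a))
    (g := (smulHom (Tens R N.carrier B.carrier) a).comp
      (Tens.map f.toAddHom f.map_op_smul (AddMonoidHom.id B.carrier) (fun _ _ => rfl)))
    (fun _ _ => rfl) x

theorem tensorMap_colinear (B : Bicomod R A C) {M N : RMod R} (f : M ⟶ N)
    (x : Tens R M.carrier B.carrier) :
    B.tensorCoact N (B.tensorMap f x) = tensorCoring C (B.tensorMap f) (B.tensorCoact M x) := by
  refine Tens.hom_congr
    (f := (B.tensorCoact N).comp (B.tensorMap f).toAddMonoidHom)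
    (g := (tensorCoring C (B.tensorMap f)).comp (B.tensorCoact M)) (fun m u => ?_) x
  exact Tens.hom_congr (f := tensorCoring C (B.pureTensor N (f.toAddHom m)))
    (g := (tensorCoring C (B.tensorMap f)).comp (tensorCoring C (B.pureTensor M m)))
    (fun _ _ => rfl) (B.coact u)

/-- The functor `- ⊗_R Σ` from (not necessarily firm) right `R`-modules to right `C`-comodules. -/
def tensor (B : Bicomod R A C) : RMod R ⥤ Comod A C where
  obj := B.tensorObj
  map f := ⟨B.tensorMap f, B.tensorMap_colinear f⟩
  map_id M := Subtype.ext (LinearMap.toAddMonoidHom_injective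
    (Tens.hom_ext (f := (B.tensorMap (𝟙 M)).toAddMonoidHom) (g := AddMonoidHom.id _)
      fun _ _ => rfl))
  map_comp f g := Subtype.ext (LinearMap.toAddMonoidHom_injective
    (Tens.hom_ext (f := (B.tensorMap (f ≫ g)).toAddMonoidHom)
      (g := (B.tensorMap g).toAddMonoidHom.comp (B.tensorMap f).toAddMonoidHom)
      fun _ _ => rfl))

/-- The functor `- ⊗_R Σ` from firm right `R`-modules to right `C`-comodules. -/
abbrev tensorFirm (B : Bicomod R A C) : FirmMod R ⥤ Comod A C :=
  (RMod.isFirm R).ι ⋙ B.tensor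

/-- The functor `Hom^C(Σ, -)` from right `C`-comodules to right `R`-modules, where
`(f r)(u) = f(r u)`. -/
def homComod (B : Bicomod R A C) : Comod A C ⥤ RMod R where
  obj N :=
    letI : SMul Rᵐᵒᵖ (B.toComod ⟶ N) := ⟨fun r f => B.lmul r.unop ≫ f⟩
    { carrier := B.toComod ⟶ N
      nuModule :=
        { smul_add := fun r f g => Preadditive.comp_add _ _ _ _ _ _
          add_smul := fun r s f => Subtype.ext (LinearMap.ext fun m => by
            change f.1 ((r.unop + s.unop) • m) = f.1 (r.unop • m) + f.1 (s.unop • m)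
            rw [NUModule.add_smul, map_add])
          mul_smul := fun r s f => Subtype.ext (LinearMap.ext fun m => by
            change f.1 ((s.unop * r.unop) • m) = f.1 (s.unop • (r.unop • m))
            rw [NUModule.mul_smul]) } }
  map {N P} g :=
    { toAddHom := AddMonoidHom.mk' (fun f => f ≫ g) (fun f f' => Preadditive.add_comp _ _ _ _ _ _)
      map_op_smul := fun _ _ => rfl }

/-- The functor `Hom^C(Σ, -) ⊗_R R` from right `C`-comodules to firm right `R`-modules. -/
abbrev homFirm [IsFirmRing R] (B : Bicomod R A C) : Comod A C ⥤ FirmMod R :=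
  B.homComod ⋙ firmification R

/-- The functor `Hom_A(Σ, -)` from right `A`-modules to right `R`-modules, where
`(f r)(u) = f(r u)`. -/
def homMod (B : Bicomod R A C) : ModuleCat.{u} Aᵐᵒᵖ ⥤ RMod R where
  obj M :=
    letI : SMul Rᵐᵒᵖ (B.carrier →ₗ[Aᵐᵒᵖ] M) := ⟨fun r f => f ∘ₗ (B.lmul r.unop).1⟩
    { carrier := B.carrier →ₗ[Aᵐᵒᵖ] M
      nuModule :=
        { smul_add := fun r f g => LinearMap.add_comp _ _ _
          add_smul := fun r s f => LinearMap.ext fun m => by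
            change f ((r.unop + s.unop) • m) = f (r.unop • m) + f (s.unop • m)
            rw [NUModule.add_smul, map_add]
          mul_smul := fun r s f => LinearMap.ext fun m => by
            change f ((s.unop * r.unop) • m) = f (s.unop • (r.unop • m))
            rw [NUModule.mul_smul] } }
  map {N P} g :=
    { toAddHom := AddMonoidHom.mk' (fun f => g.hom ∘ₗ f) (fun f f' => LinearMap.comp_add _ _ _)
      map_op_smul := fun _ _ => rfl }

end Bicomod

variable (A C)

/-- The coring `C` as an `A`-`C`-bicomodule, with coaction the comultiplication. -/
def coringBicomod : Bicomod A A C where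
  carrier := C
  coact :=
    { toFun := Coring.comul
      map_add' := map_add _
      map_smul' := fun a c => Coring.comul_op_smul a.unop c }
  coassoc := Coring.coassoc
  counit := Coring.counit_right
  coact_smul := Coring.comul_smul

/-- Unital right `A`-modules as modules over the underlying non-unital ring of `A`. -/
def forgetUnit : ModuleCat.{u} Aᵐᵒᵖ ⥤ RMod A where
  obj M := ⟨M⟩
  map f := ⟨f.hom.toAddMonoidHom, fun a m => f.hom.map_smul (op a) m⟩

/-- The functor `- ⊗_A C` from right `A`-modules to right `C`-comodules, with the coaction
`M ⊗_A Δ` on `M ⊗_A C`. -/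
abbrev cofree : ModuleCat.{u} Aᵐᵒᵖ ⥤ Comod A C :=
  forgetUnit A ⋙ (coringBicomod A C).tensor

end Bicomodules

end FirmCoring

open FirmCoring

/-! This is an Eilenberg–Watts theorem in which firmness replaces the unit. A left adjoint preserves
colimits, so (i) gives (ii). For (ii) ⇒ (iii), firmness of `M` says that `M` is `M ⊗_R R`: it is
generated by the maps `orbit M m : R → M`, `r ↦ m r`, subject only to additivity in `m` and to
`orbit M (m r) = lmul r ≫ orbit M m`. Hence `M` is a coequalizer of maps between direct sums of
copies of `R` (`FirmMod.nonempty_isColimit`). A functor as in (ii) preserves this presentation and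
is automatically additive, so the relations keep their form after applying `F`. Thus colinear maps
out of `F(M)` are the balanced additive families of colinear maps out of `F(R)`
(`FirmMod.map_orbit_hom_ext`, `FirmMod.exists_map_desc`). Maps out of `M ⊗_R F(R)` have the same
description (`Bicomod.tensorObj_hom_ext`, `Bicomod.tensorLift`), whence `F(M) ≅ M ⊗_R F(R)`; the
case `M = R` shows that `F(R)` is firm. For (iii) ⇒ (i), two adjunctions are composed: the inclusion
of firm modules is left adjoint to `- ⊗_R R` (`firmificationAdj`), and `- ⊗_R Σ` on all modules is
left adjoint to `Hom^C(Σ, -)` (`Bicomod.tensorAdj`). Every other right adjoint agrees with the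
composite by uniqueness. The canonical map comes from tensor-hom: a linear `f : Σ → M` gives the
colinear map `u ↦ f(u₀) ⊗ u₁` into the cofree comodule, and this family is balanced. -/

namespace FirmCoring

/-! ### Firm modules -/

namespace RMod

variable {R : Type u} [NonUnitalRing R]

/-- Right linear maps form an abelian group under pointwise addition. -/
instance (M N : RMod R) : AddCommGroup (M ⟶ N) :=
  letI : Add (M ⟶ N) := ⟨fun f g => RMod.Hom.mk (f.toAddHom + g.toAddHom) fun r m => by
    change f.toAddHom _ + g.toAddHom _ = op r • (f.toAddHom m + g.toAddHom m)
    rw [f.map_op_smul, g.map_op_smul, NUModule.smul_add]⟩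
  letI : Zero (M ⟶ N) := ⟨RMod.Hom.mk 0 fun r _ => (map_zero (smulHom N.carrier (op r))).symm⟩
  letI : Neg (M ⟶ N) := ⟨fun f => RMod.Hom.mk (-f.toAddHom) fun r m => by
    change -f.toAddHom _ = op r • (-f.toAddHom m)
    rw [f.map_op_smul]
    exact (map_neg (smulHom N.carrier (op r)) (f.toAddHom m)).symm⟩
  { AddGroup.ofLeftAxioms (fun f g h => RMod.Hom.ext (add_assoc f.toAddHom g.toAddHom h.toAddHom))
      (fun f => RMod.Hom.ext (zero_add f.toAddHom))
      (fun f => RMod.Hom.ext (neg_add_cancel f.toAddHom)) with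
    add_comm := fun f g => RMod.Hom.ext (add_comm f.toAddHom g.toAddHom) }

/-- Sums of morphisms are needed to write additivity in `m` as a relation between maps out of `R`,
and to speak of additive functors. -/
instance : Preadditive (RMod R) where
  homGroup := inferInstance
  add_comp _ _ _ f f' g := RMod.Hom.ext (AddMonoidHom.comp_add g.toAddHom f.toAddHom f'.toAddHom)
  comp_add _ _ _ f g g' := RMod.Hom.ext (AddMonoidHom.add_comp g.toAddHom g'.toAddHom f.toAddHom)

/-- Multiplication `M ⊗_R R → M` is right linear. -/
theorem mulRight_smul (M : RMod R) (r : R) (x : Tens R M.carrier R) :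
    mulRight R M.carrier (op r • x) = op r • mulRight R M.carrier x :=
  Tens.hom_congr (f := (mulRight R M.carrier).comp (smulHom _ (op r)))
    (g := (smulHom _ (op r)).comp (mulRight R M.carrier))
    (fun m s => NUModule.mul_smul (op r) (op s) m) x

/-- Right linear maps commute with multiplication. -/
theorem mulRight_map {M N : RMod R} (f : M ⟶ N) (x : Tens R M.carrier R) :
    mulRight R N.carrier (Tens.map f.toAddHom f.map_op_smul (AddMonoidHom.id R)
      (fun _ _ => rfl) x) = f.toAddHom (mulRight R M.carrier x) :=
  Tens.hom_congr
    (f := (mulRight R N.carrier).comp (Tens.map f.toAddHom f.map_op_smul (AddMonoidHom.id R)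
      (fun _ _ => rfl)))
    (g := f.toAddHom.comp (mulRight R M.carrier)) (fun m r => (f.map_op_smul r m).symm) x

/-- A module is firm as soon as multiplication has a one-sided inverse `d` such that
`d (m r) = m ⊗ r`. -/
theorem isFirm_of_inverse {M : RMod R} (d : M.carrier →+ Tens R M.carrier R)
    (hd : ∀ m, mulRight R M.carrier (d m) = m)
    (hd' : ∀ (m : M.carrier) (r : R), d (op r • m) = Tens.tmul R m r) : isFirm R M :=
  Function.bijective_iff_has_inverse.2 ⟨d, fun x =>
    Tens.hom_congr (f := d.comp (mulRight R M.carrier)) (g := AddMonoidHom.id _) hd' x, hd⟩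

/-- A linear map from a firm module is determined by its values on products. -/
theorem hom_ext_of_isFirm {M N : RMod R} (hM : isFirm R M) {f g : M ⟶ N}
    (h : ∀ (m : M.carrier) (r : R), f.toAddHom (op r • m) = g.toAddHom (op r • m)) : f = g := by
  refine RMod.Hom.ext (AddMonoidHom.ext fun m => ?_)
  obtain ⟨x, rfl⟩ := hM.2 m
  exact Tens.hom_congr (f := f.toAddHom.comp (mulRight R M.carrier))
    (g := g.toAddHom.comp (mulRight R M.carrier)) h x

/-- The direct sum of a family of modules. -/
def directSum {J : Type u} (M : J → RMod R) : RMod R :=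
  letI : SMul Rᵐᵒᵖ (Π₀ j, (M j).carrier) :=
    ⟨fun r => DFinsupp.mapRange (fun _ m => r • m) fun j => map_zero (smulHom (M j).carrier r)⟩
  { carrier := Π₀ j, (M j).carrier
    nuModule :=
      { smul_add := fun r x y => DFinsupp.ext fun j => NUModule.smul_add r (x j) (y j)
        add_smul := fun r s x => DFinsupp.ext fun j => NUModule.add_smul r s (x j)
        mul_smul := fun r s x => DFinsupp.ext fun j => NUModule.mul_smul r s (x j) } }

open Classical in
/-- The inclusion of a summand. -/
noncomputable def directSumι {J : Type u} (M : J → RMod R) (j : J) : M j ⟶ directSum M :=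
  RMod.Hom.mk (DFinsupp.singleAddHom (fun j => (M j).carrier) j) fun r _ =>
    (DFinsupp.mapRange_single (f := fun j (m : (M j).carrier) => op r • m)
      (hf := fun j => map_zero (smulHom (M j).carrier (op r)))).symm

open Classical in
theorem directSum_addHom_ext {J : Type u} {M : J → RMod R} {P : Type*} [AddCommGroup P]
    {f g : (directSum M).carrier →+ P}
    (h : ∀ j m, f ((directSumι M j).toAddHom m) = g ((directSumι M j).toAddHom m)) : f = g :=
  DFinsupp.addHom_ext h

open Classical in
/-- The additive map out of the direct sum given by a family of additive maps. -/
noncomputable def directSumLift {J : Type u} (M : J → RMod R) {P : Type*} [AddCommGroup P]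
    (f : ∀ j, (M j).carrier →+ P) : (directSum M).carrier →+ P :=
  DFinsupp.liftAddHom f

open Classical in
theorem directSumLift_ι {J : Type u} (M : J → RMod R) {P : Type*} [AddCommGroup P]
    (f : ∀ j, (M j).carrier →+ P) (j : J) (m : (M j).carrier) :
    directSumLift M f ((directSumι M j).toAddHom m) = f j m :=
  DFinsupp.liftAddHom_apply_single _ _ _

/-- The map out of the direct sum given by a family of maps. -/
noncomputable def directSumDesc {J : Type u} (M : J → RMod R) {N : RMod R}
    (f : ∀ j, M j ⟶ N) : directSum M ⟶ N :=
  RMod.Hom.mk (directSumLift M fun j => (f j).toAddHom) fun r m => by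
    refine DFunLike.congr_fun (directSum_addHom_ext
      (f := (directSumLift M fun j => (f j).toAddHom).comp (smulHom _ (op r)))
      (g := (smulHom _ (op r)).comp (directSumLift M fun j => (f j).toAddHom))
      fun j m => ?_) m
    change directSumLift M (fun j => (f j).toAddHom) (op r • (directSumι M j).toAddHom m)
      = op r • directSumLift M (fun j => (f j).toAddHom) ((directSumι M j).toAddHom m)
    rw [← (directSumι M j).map_op_smul, directSumLift_ι, directSumLift_ι, (f j).map_op_smul]

/-- Tensoring with `R` commutes with direct sums, so the inverses of the multiplications of the
summands assemble to an inverse of the multiplication of the sum. -/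
theorem isFirm_directSum {J : Type u} {M : J → RMod R} (hM : ∀ j, isFirm R (M j)) :
    isFirm R (directSum M) := by
  let e (j : J) : Tens R (M j).carrier R ≃+ (M j).carrier := AddEquiv.ofBijective _ (hM j)
  let i (j : J) := Tens.map (directSumι M j).toAddHom (directSumι M j).map_op_smul
    (AddMonoidHom.id R) (fun _ _ => rfl)
  let d := directSumLift M fun j => (i j).comp (e j).symm.toAddMonoidHom
  have hdι : ∀ j m, d ((directSumι M j).toAddHom m) = i j ((e j).symm m) :=
    directSumLift_ι M _
  refine isFirm_of_inverse d (DFunLike.congr_fun (directSum_addHom_ext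
    (f := (mulRight R _).comp d) (g := AddMonoidHom.id _) fun j m => ?_)) fun m r =>
    DFunLike.congr_fun (directSum_addHom_ext (f := d.comp (smulHom _ (op r)))
      (g := (Tens.mk R).flip r) fun j m => ?_) m
  · change mulRight R _ (d _) = _
    rw [hdι, mulRight_map]
    exact congrArg _ ((e j).apply_symm_apply m)
  · change d (op r • (directSumι M j).toAddHom m) = _
    rw [← (directSumι M j).map_op_smul, hdι]
    exact congrArg (i j) ((e j).symm_apply_apply (Tens.tmul R m r))

end RMod

/-! ### Coproducts of firm modules, and maps from `R` to a firm module -/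

namespace FirmMod

variable {R : Type u} [NonUnitalRing R]

/-- The direct sum of firm modules, as a cofan. -/
noncomputable def cofan {J : Type u} (M : J → FirmMod R) : Cofan M :=
  Cofan.mk (⟨RMod.directSum fun j => (M j).obj, RMod.isFirm_directSum fun j => (M j).property⟩ :
    FirmMod R) fun j => ObjectProperty.homMk (RMod.directSumι (fun j => (M j).obj) j)

/-- The direct sum of firm modules is a coproduct. -/
noncomputable def isColimitCofan {J : Type u} (M : J → FirmMod R) : IsColimit (cofan M) :=
  Cofan.IsColimit.mk _ (fun s => ObjectProperty.homMk
      (RMod.directSumDesc (fun j => (M j).obj) fun j => (s.inj j).hom))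
    (fun s j => ObjectProperty.hom_ext _ (RMod.Hom.ext (AddMonoidHom.ext fun m =>
      RMod.directSumLift_ι (fun j => (M j).obj)
        (fun j => (s.inj j).hom.toAddHom) j m)))
    (fun s f hf => ObjectProperty.hom_ext _ (RMod.Hom.ext (RMod.directSum_addHom_ext fun j m => by
      refine Eq.trans ?_ (RMod.directSumLift_ι (fun j => (M j).obj)
        (fun j => (s.inj j).hom.toAddHom) j m).symm
      rw [← hf j]
      rfl)))

instance : HasCoproducts.{u} (FirmMod R) :=
  hasCoproducts_of_colimit_cofans cofan isColimitCofan

instance : HasFiniteCoproducts (FirmMod R) := hasFiniteCoproducts_of_hasCoproducts.{u} _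

instance : HasBinaryBiproducts (FirmMod R) := HasBinaryBiproducts.of_hasBinaryCoproducts

instance : HasZeroObject (FirmMod R) := hasZeroObject_of_hasInitial_object

variable [IsFirmRing R]

/-- The right linear map `R → M`, `r ↦ m r`. -/
def orbit (M : FirmMod R) (m : M.obj.carrier) : self R ⟶ M :=
  ObjectProperty.homMk (show RMod.Hom ⟨R⟩ M.obj from
    ⟨AddMonoidHom.mk' (fun r => op r • m) fun r s => NUModule.add_smul (op r) (op s) m,
      fun r s => NUModule.mul_smul (op r) (op s) m⟩)

theorem orbit_add (M : FirmMod R) (m m' : M.obj.carrier) :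
    orbit M (m + m') = orbit M m + orbit M m' :=
  ObjectProperty.hom_ext _ (RMod.Hom.ext (AddMonoidHom.ext fun (r : R) =>
    NUModule.smul_add (op r) m m'))

/-- This is associativity `(m r) s = m (r s)`, read as balancedness of the family of orbit maps. -/
theorem orbit_smul (M : FirmMod R) (r : R) (m : M.obj.carrier) :
    orbit M (op r • m) = lmul R r ≫ orbit M m :=
  ObjectProperty.hom_ext _ (RMod.Hom.ext (AddMonoidHom.ext fun (s : R) =>
    (NUModule.mul_smul (op s) (op r) m).symm))

theorem orbit_comp {M N : FirmMod R} (f : M ⟶ N) (m : M.obj.carrier) :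
    orbit M m ≫ f = orbit N (f.hom.toAddHom m) :=
  ObjectProperty.hom_ext _ (RMod.Hom.ext (AddMonoidHom.ext fun r => f.hom.map_op_smul r m))

/-- Surjectivity of `M ⊗_R R → M` makes every element a sum of products `m r`, that is, of values of
orbit maps. -/
theorem hom_ext {M N : FirmMod R} {f g : M ⟶ N} (h : ∀ m, orbit M m ≫ f = orbit M m ≫ g) :
    f = g :=
  ObjectProperty.hom_ext _ (RMod.hom_ext_of_isFirm M.property fun m r =>
    congrArg (fun k : self R ⟶ N => k.hom.toAddHom r) (h m))

/-- A firm module `M` is the quotient of the direct sum of copies of `R` indexed by `M`, modulo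
additivity in `M` and balancedness over `R`. -/
theorem exists_desc {M N : FirmMod R} (h : M.obj.carrier → (self R ⟶ N))
    (hadd : ∀ m m', h (m + m') = h m + h m')
    (hsmul : ∀ (r : R) m, h (op r • m) = lmul R r ≫ h m) :
    ∃ k : M ⟶ N, ∀ m, orbit M m ≫ k = h m := by
  -- The family defines a map on `M ⊗_R R`; full firmness, injectivity of multiplication included,
  -- transports it to `M`.
  let e : Tens R M.obj.carrier R ≃+ M.obj.carrier := AddEquiv.ofBijective _ M.property
  let l : Tens R M.obj.carrier R →+ N.obj.carrier :=
    Tens.lift (AddMonoidHom.mk' (fun m => (h m).hom.toAddHom)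
      (fun m m' => congrArg (fun k : self R ⟶ N => k.hom.toAddHom) (hadd m m')))
      fun r m s => congrArg (fun k : self R ⟶ N => k.hom.toAddHom s) (hsmul r m)
  have hl : ∀ (r : R) x, l (op r • x) = op r • l x := fun r x =>
    Tens.hom_congr (f := l.comp (smulHom _ (op r))) (g := (smulHom _ (op r)).comp l)
      (fun m s => (h m).hom.map_op_smul r s) x
  refine ⟨ObjectProperty.homMk (show RMod.Hom M.obj N.obj from
    ⟨l.comp e.symm.toAddMonoidHom, fun r m => ?_⟩), fun m => ObjectProperty.hom_ext _
      (RMod.Hom.ext (AddMonoidHom.ext fun r => ?_))⟩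
  · obtain ⟨x, rfl⟩ := e.surjective m
    change l (e.symm (op r • mulRight R _ x)) = op r • l (e.symm (e x))
    rw [← RMod.mulRight_smul, e.symm_apply_apply, ← hl]
    exact congrArg l (e.symm_apply_apply _)
  · exact congrArg l (e.symm_apply_apply (Tens.tmul R m r))

end FirmMod

end FirmCoring
-- Firm modules as coequalizers of sums of copies of `R`, and right exact functors
namespace FirmCoring

section RightExact

variable {R : Type u} [NonUnitalRing R] {D : Type*} [Category* D]

/-- A functor preserving finite colimits is additive on firm modules. -/
theorem FirmMod.additive_of_preservesFiniteColimits [Preadditive D] (F : FirmMod R ⥤ D)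
    [PreservesFiniteColimits F] : F.Additive := by
  -- No zero object is assumed in `D`: the image of the initial object is initial, and an initial
  -- object of a preadditive category is zero. Preserved binary coproducts are then preserved
  -- biproducts, which determine addition of morphisms.
  have hI : IsInitial (F.obj (⊥_ FirmMod R)) := IsInitial.isInitialObj F _ initialIsInitial
  have : HasInitial D := hI.hasInitial
  have : HasZeroObject D := hasZeroObject_of_hasInitial_object
  have : PreservesBinaryBiproducts F := preservesBinaryBiproducts_of_preservesBinaryCoproducts F
  exact Functor.additive_of_preservesBinaryBiproducts F

variable [IsFirmRing R]

/-- The relations presenting a firm module `M` as a quotient of a direct sum of copies of `R`: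
additivity in `M`, and balancedness over `R`. -/
abbrev FirmMod.Relation (M : FirmMod R) : Type u :=
  (M.obj.carrier × M.obj.carrier) ⊕ (M.obj.carrier × R)

namespace FirmMod

variable (M : FirmMod R)

/-- The left-hand sides of the relations presenting `M`. -/
noncomputable def relationLeft :
    ∐ (fun _ : Relation M => self R) ⟶ ∐ (fun _ : M.obj.carrier => self R) :=
  Sigma.desc (Sum.elim
    (fun p => Sigma.ι (fun _ : M.obj.carrier => self R) (p.1 + p.2))
    (fun p => Sigma.ι (fun _ : M.obj.carrier => self R) (op p.2 • p.1)))

/-- The right-hand sides of the relations presenting `M`. -/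
noncomputable def relationRight :
    ∐ (fun _ : Relation M => self R) ⟶ ∐ (fun _ : M.obj.carrier => self R) :=
  Sigma.desc (Sum.elim
    (fun p => Sigma.ι (fun _ : M.obj.carrier => self R) p.1 +
      Sigma.ι (fun _ : M.obj.carrier => self R) p.2)
    (fun p => lmul R p.2 ≫ Sigma.ι (fun _ : M.obj.carrier => self R) p.1))

/-- The map `⨁ R → M` given by multiplication. -/
noncomputable def orbits : ∐ (fun _ : M.obj.carrier => self R) ⟶ M := Sigma.desc (orbit M)

theorem ι_orbits (m : M.obj.carrier) :
    Sigma.ι (fun _ : M.obj.carrier => self R) m ≫ orbits M = orbit M m :=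
  Sigma.ι_desc _ _

theorem relation_orbits : relationLeft M ≫ orbits M = relationRight M ≫ orbits M := by
  refine Sigma.hom_ext _ _ ?_
  rintro (⟨m, m'⟩ | ⟨m, r⟩)
  · simp [relationLeft, relationRight, orbits, orbit_add]
  · simp [relationLeft, relationRight, orbits, orbit_smul]

/-- A firm module is the coequalizer of the relations presenting it. -/
theorem nonempty_isColimit : Nonempty (IsColimit (Cofork.ofπ (orbits M) (relation_orbits M))) := by
  -- The components of a cofork on the summands of `⨁ R` form a family indexed by `M`; the cofork
  -- condition on the two kinds of relation is exactly additivity and balancedness.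
  have hex (s : Cofork (relationLeft M) (relationRight M)) :
      ∃ k : M ⟶ s.pt, ∀ m, orbit M m ≫ k = Sigma.ι (fun _ : M.obj.carrier => self R) m ≫ s.π := by
    refine exists_desc _ (fun m m' => ?_) fun r m => ?_
    · have := Sigma.ι (fun _ : Relation M => self R) (Sum.inl (m, m')) ≫= s.condition
      simpa [relationLeft, relationRight] using this
    · have := Sigma.ι (fun _ : Relation M => self R) (Sum.inr (m, r)) ≫= s.condition
      simpa [relationLeft, relationRight] using this
  choose k hk using hex
  refine ⟨Cofork.IsColimit.mk _ k (fun s => Sigma.hom_ext _ _ fun m => ?_)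
    fun s l hl => FirmMod.hom_ext fun m => ?_⟩
  · change Sigma.ι (fun _ : M.obj.carrier => self R) m ≫ orbits M ≫ k s = _
    rw [← Category.assoc, ι_orbits, hk]
  · refine Eq.trans ?_ (hk s m).symm
    rw [← hl]
    exact (congrArg (· ≫ l) (ι_orbits M m).symm).trans (Category.assoc _ _ _)

variable (F : FirmMod R ⥤ D) [PreservesFiniteColimits F]
  [∀ J : Type u, PreservesColimitsOfShape (Discrete J) F]

/-- The value at `M` of a right exact functor that preserves direct sums: maps out of it agree
if they agree on the images of the maps `R → M`. -/
theorem map_orbit_hom_ext {X : D} {f g : F.obj M ⟶ X}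
    (h : ∀ m, F.map (orbit M m) ≫ f = F.map (orbit M m) ≫ g) : f = g := by
  obtain ⟨hM⟩ := nonempty_isColimit M
  have hF := isColimitCoforkMapOfIsColimit F _ hM
  have hQ := isColimitCofanMkObjOfIsColimit F _ _
    (coproductIsCoproduct fun _ : M.obj.carrier => self R)
  refine Cofork.IsColimit.hom_ext hF (Cofan.IsColimit.hom_ext hQ _ _ fun m => ?_)
  have hm : F.map (Sigma.ι (fun _ : M.obj.carrier => self R) m) ≫ F.map (orbits M)
      = F.map (orbit M m) := by rw [← F.map_comp, ι_orbits]
  change F.map (Sigma.ι (fun _ : M.obj.carrier => self R) m) ≫ F.map (orbits M) ≫ f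
    = F.map (Sigma.ι (fun _ : M.obj.carrier => self R) m) ≫ F.map (orbits M) ≫ g
  rw [← Category.assoc, ← Category.assoc, hm, h]

/-- The value at `M` of a right exact functor that preserves direct sums: maps out of it are
given by balanced families of maps out of `F(R)`. -/
theorem exists_map_desc [Preadditive D] {X : D} (h : M.obj.carrier → (F.obj (self R) ⟶ X))
    (hadd : ∀ m m', h (m + m') = h m + h m')
    (hsmul : ∀ (r : R) m, h (op r • m) = F.map (lmul R r) ≫ h m) :
    ∃ k : F.obj M ⟶ X, ∀ m, F.map (orbit M m) ≫ k = h m := by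
  -- Additivity of `F` turns the image of `ι m + ι m'` in `relationRight` into a sum of images.
  have := additive_of_preservesFiniteColimits F
  obtain ⟨hM⟩ := nonempty_isColimit M
  have hF := isColimitCoforkMapOfIsColimit F _ hM
  have hQ := isColimitCofanMkObjOfIsColimit F _ _
    (coproductIsCoproduct fun _ : M.obj.carrier => self R)
  have hP := isColimitCofanMkObjOfIsColimit F _ _
    (coproductIsCoproduct fun _ : Relation M => self R)
  let H : F.obj (∐ fun _ : M.obj.carrier => self R) ⟶ X := Cofan.IsColimit.desc hQ h
  have hH : ∀ m, F.map (Sigma.ι (fun _ : M.obj.carrier => self R) m) ≫ H = h m :=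
    Cofan.IsColimit.fac hQ h
  have hrel : F.map (relationLeft M) ≫ H = F.map (relationRight M) ≫ H := by
    -- The image under `F` of the sum over relations is again a coproduct, so each relation can be
    -- tested separately.
    refine Cofan.IsColimit.hom_ext hP _ _ fun p => ?_
    change F.map (Sigma.ι (fun _ : Relation M => self R) p) ≫ F.map (relationLeft M) ≫ H
      = F.map (Sigma.ι (fun _ : Relation M => self R) p) ≫ F.map (relationRight M) ≫ H
    rw [← F.map_comp_assoc, ← F.map_comp_assoc, relationLeft, relationRight, Sigma.ι_desc,
      Sigma.ι_desc]
    obtain ⟨m, m'⟩ | ⟨m, r⟩ := p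
    · simp [Functor.map_add, hH, hadd]
    · simp [hH, hsmul]
  refine ⟨Cofork.IsColimit.desc hF H hrel, fun m => ?_⟩
  have hm : F.map (orbit M m)
      = F.map (Sigma.ι (fun _ : M.obj.carrier => self R) m) ≫ F.map (orbits M) := by
    rw [← F.map_comp, ι_orbits]
  rw [hm, Category.assoc, ← hH m]
  exact congrArg _ (Cofork.IsColimit.π_desc' hF H hrel)

end FirmMod

end RightExact

end FirmCoring
-- The adjunction between `- ⊗_R Σ` and `Hom^C(Σ, -)`
namespace FirmCoring

section Bicomodules

variable {R : Type u} [NonUnitalRing R] {A : Type u} [Ring A] {C : Type u} [AddCommGroup C]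
  [Module A C] [Module Aᵐᵒᵖ C] [SMulCommClass A Aᵐᵒᵖ C] [Coring A C]

namespace Bicomod

variable (B : Bicomod R A C)

/-- The colinear map `u ↦ m ⊗ u`. -/
def pure (M : RMod R) (m : M.carrier) : B.toComod ⟶ B.tensorObj M :=
  ⟨B.pureTensor M m, fun _ => rfl⟩

variable {B}

/-- Colinear maps out of `M ⊗_R Σ` agree if they agree on pure tensors. -/
theorem tensorObj_hom_ext {M : RMod R} {N : Comod A C} {f g : B.tensorObj M ⟶ N}
    (h : ∀ m, B.pure M m ≫ f = B.pure M m ≫ g) : f = g :=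
  Subtype.ext (LinearMap.toAddMonoidHom_injective (Tens.hom_ext
    (f := f.1.toAddMonoidHom) (g := g.1.toAddMonoidHom) fun m u =>
      congrArg (fun k : B.toComod ⟶ N => k.1 u) (h m)))

/-- The colinear map out of `M ⊗_R Σ` induced by a balanced family of colinear maps out of `Σ`. -/
def tensorLift {M : RMod R} {N : Comod A C} (h : M.carrier →+ (B.toComod ⟶ N))
    (hsmul : ∀ (r : R) m, h (op r • m) = B.lmul r ≫ h m) : B.tensorObj M ⟶ N :=
  let l : Tens R M.carrier B.carrier →+ N.carrier :=
    Tens.lift (AddMonoidHom.mk' (fun m => (h m).1.toAddMonoidHom) fun m m' =>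
        congrArg (fun k : B.toComod ⟶ N => k.1.toAddMonoidHom) (map_add h m m'))
      fun r m u => congrArg (fun k : B.toComod ⟶ N => k.1 u) (hsmul r m)
  let l' : Tens R M.carrier B.carrier →ₗ[Aᵐᵒᵖ] N.carrier :=
    { l with
      map_smul' := fun a x => Tens.hom_congr (f := l.comp (smulHom _ a))
        (g := (smulHom _ a).comp l) (fun m u => (h m).1.map_smul a u) x }
  -- On `m ⊗ u` colinearity reduces to that of `h m`, since `h m` is `l'` composed with `u ↦ m ⊗ u`.
  ⟨l', fun x => Tens.hom_congr (f := N.coact.toAddMonoidHom.comp l)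
    (g := (tensorCoring C l').comp (B.tensorCoact M)) (fun m u => by
      refine ((h m).2 u).trans ?_
      change _ = tensorCoring C l' (tensorCoring C (B.pureTensor M m) (B.coact u))
      rw [← tensorCoring_comp]
      rfl) x⟩

theorem pure_add (M : RMod R) (m m' : M.carrier) :
    B.pure M (m + m') = B.pure M m + B.pure M m' :=
  Subtype.ext (LinearMap.ext fun u => Tens.add_tmul m m' u)

theorem pure_smul (M : RMod R) (r : R) (m : M.carrier) :
    B.pure M (op r • m) = B.lmul r ≫ B.pure M m :=
  Subtype.ext (LinearMap.ext fun u => Tens.smul_tmul r m u)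

variable (B)

/-- The functor `- ⊗_R Σ` is left adjoint to `Hom^C(Σ, -)`. -/
def tensorAdj : B.tensor ⊣ B.homComod :=
  Adjunction.mkOfHomEquiv
    { homEquiv := fun M N =>
        { toFun := fun f => RMod.Hom.mk
            (AddMonoidHom.mk' (fun m => (B.pure M m ≫ f : B.toComod ⟶ N)) fun m m' =>
              (congrArg (· ≫ f) (pure_add M m m')).trans (Preadditive.add_comp _ _ _ _ _ _))
            fun r m => congrArg (· ≫ f) (pure_smul M r m)
          invFun := fun g => tensorLift (N := N) g.toAddHom g.map_op_smul
          left_inv := fun _ => tensorObj_hom_ext fun _ => rfl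
          right_inv := fun _ => rfl }
      homEquiv_naturality_left_symm := fun _ _ => tensorObj_hom_ext fun _ => rfl
      homEquiv_naturality_right := fun _ _ => rfl }

/-- Left multiplication as a ring morphism `R → End^C(Σ)`. -/
def lmulHom : R →ₙ+* End B.toComod where
  toFun := B.lmul
  map_mul' r s := Subtype.ext (LinearMap.ext fun u => NUModule.mul_smul r s u)
  map_zero' := Subtype.ext (LinearMap.ext fun u => by
    -- `0 • u = 0` is not an axiom of `NUModule`; it follows from additivity by cancellation.
    have h : (0 : R) • u + (0 : R) • u = (0 : R) • u + 0 := by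
      rw [← NUModule.add_smul, add_zero, add_zero]
    exact add_left_cancel h)
  map_add' r s := Subtype.ext (LinearMap.ext fun u => NUModule.add_smul r s u)

/-! ### The canonical map -/

variable {B} in
/-- The colinear map `u ↦ f(u₀) ⊗ u₁` corresponding to the linear map `f`. -/
def cofreeLift {M : ModuleCat.{u} Aᵐᵒᵖ} (f : B.carrier →ₗ[Aᵐᵒᵖ] M) :
    B.toComod ⟶ (cofree A C).obj M :=
  let l : B.carrier →ₗ[Aᵐᵒᵖ] Tens A M C := tensorCoringLin C f ∘ₗ B.coact
  ⟨l, fun u =>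
    -- Naturality of `- ⊗_A Δ` in `f` moves the comultiplication past `f`; coassociativity of `Σ`
    -- then gives colinearity.
    (coassoc_tensorCoring f (B.coact u)).trans
      ((congrArg (tensorCoring C (tensorCoringLin C f)) (B.coassoc u)).trans
        (tensorCoring_comp (tensorCoringLin C f) B.coact (B.coact u)).symm)⟩

variable {B} in
theorem cofreeLift_add {M : ModuleCat.{u} Aᵐᵒᵖ} (f g : B.carrier →ₗ[Aᵐᵒᵖ] M) :
    cofreeLift (f + g) = cofreeLift f + cofreeLift g :=
  Subtype.ext (LinearMap.ext fun u =>
    Tens.hom_congr (f := tensorCoring C (f + g)) (g := tensorCoring C f + tensorCoring C g)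
      (fun m c => Tens.add_tmul (f m) (g m) c) (B.coact u))

/-- Left `R`-linearity of the coaction gives `f(r u₀) ⊗ u₁ = f((r u)₀) ⊗ (r u)₁`; this is the
balancedness that lets `can` descend to the tensor product over `R`. -/
theorem cofreeLift_comp_lmul {M : ModuleCat.{u} Aᵐᵒᵖ} (f : B.carrier →ₗ[Aᵐᵒᵖ] M) (r : R) :
    cofreeLift (f ∘ₗ (B.lmul r).1) = B.lmul r ≫ cofreeLift f :=
  Subtype.ext (LinearMap.ext fun u =>
    (tensorCoring_comp f (B.lmul r).1 (B.coact u)).trans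
      (congrArg (tensorCoring C f) (B.coact_smul r u).symm))

/-- The component `f ⊗ u ↦ f(u₀) ⊗ u₁` of the canonical map. -/
def canApp (M : ModuleCat.{u} Aᵐᵒᵖ) : B.tensorObj (B.homMod.obj M) ⟶ (cofree A C).obj M :=
  tensorLift (N := (cofree A C).obj M) (AddMonoidHom.mk' cofreeLift cofreeLift_add)
    fun r f => B.cofreeLift_comp_lmul f r

/-- The canonical map `Hom_A(Σ, -) ⊗_R Σ → - ⊗_A C`. -/
def can : B.homMod ⋙ B.tensor ⟶ cofree A C where
  app := B.canApp
  naturality M _ g := tensorObj_hom_ext fun f => Subtype.ext (LinearMap.ext fun u =>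
    tensorCoring_comp g.hom (show B.carrier →ₗ[Aᵐᵒᵖ] M from f) (B.coact u))

end Bicomod

/-! ### Firm modules as a coreflective subcategory -/

variable [IsFirmRing R]

/-- A firm module `M` as the firm module `M ⊗_R R`. -/
noncomputable def FirmMod.toFirmification (M : FirmMod R) : M ⟶ (firmification R).obj M.obj :=
  let e : Tens R M.obj.carrier R ≃+ M.obj.carrier := AddEquiv.ofBijective _ M.property
  ObjectProperty.homMk (show RMod.Hom M.obj ⟨Tens R M.obj.carrier R⟩ from
    ⟨e.symm.toAddMonoidHom, fun r m => e.injective (by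
      refine (e.apply_symm_apply _).trans (Eq.trans ?_ (RMod.mulRight_smul M.obj r _).symm)
      exact congrArg _ (e.apply_symm_apply m).symm)⟩)

theorem FirmMod.mulRight_toFirmification (M : FirmMod R) (m : M.obj.carrier) :
    mulRight R M.obj.carrier ((FirmMod.toFirmification M).hom.toAddHom m) = m :=
  (AddEquiv.ofBijective _ M.property).apply_symm_apply m

/-- The inclusion of firm modules is left adjoint to `- ⊗_R R`. -/
noncomputable def firmificationAdj : (RMod.isFirm R).ι ⊣ firmification R where
  unit :=
    { app := FirmMod.toFirmification
      naturality := fun M N f => by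
        refine ObjectProperty.hom_ext _ (RMod.Hom.ext (AddMonoidHom.ext fun m => ?_))
        -- Multiplication on the firm module `N` is injective, so naturality may be tested after
        -- multiplying, where the unit cancels.
        refine N.property.1 ((FirmMod.mulRight_toFirmification N _).trans ?_)
        refine Eq.trans ?_ (RMod.mulRight_map f.hom ((FirmMod.toFirmification M).hom.toAddHom m)).symm
        exact congrArg f.hom.toAddHom (FirmMod.mulRight_toFirmification M m).symm }
  counit :=
    { app := fun X => RMod.Hom.mk (mulRight R X.carrier) (RMod.mulRight_smul X)
      naturality := fun X Y f => RMod.Hom.ext (AddMonoidHom.ext (RMod.mulRight_map f)) }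
  left_triangle_components M :=
    RMod.Hom.ext (AddMonoidHom.ext fun m => FirmMod.mulRight_toFirmification M m)
  right_triangle_components X := by
    refine ObjectProperty.hom_ext _ (RMod.Hom.ext (AddMonoidHom.ext fun w => ?_))
    -- The two multiplications `(X ⊗_R R) ⊗_R R → X ⊗_R R` agree, because `x r ⊗ s = x ⊗ r s`; the
    -- unit is a section of the second one.
    refine Eq.trans (Tens.hom_congr
      (f := Tens.map (mulRight R X.carrier) (RMod.mulRight_smul X) (AddMonoidHom.id R)
        (fun _ _ => rfl))
      (g := mulRight R (Tens R X.carrier R)) (fun y s => ?_) _)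
      (FirmMod.mulRight_toFirmification ((firmification R).obj X) w)
    exact Tens.hom_congr (f := ((Tens.mk R).flip s).comp (mulRight R X.carrier))
      (g := smulHom (Tens R X.carrier R) (op s)) (fun x r => Tens.smul_tmul r x s) y

end Bicomodules

end FirmCoring
-- The bicomodule `F(R)` and the isomorphism of `F` with `- ⊗_R F(R)`
namespace FirmCoring

variable {R : Type u} [NonUnitalRing R] [IsFirmRing R] {A : Type u} [Ring A] {C : Type u}
  [AddCommGroup C] [Module A C] [Module Aᵐᵒᵖ C] [SMulCommClass A Aᵐᵒᵖ C] [Coring A C]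

/-- Isomorphisms of comodules are bijective. -/
theorem Comod.bijective_of_iso {M N : Comod A C} (e : M ≅ N) : Function.Bijective e.hom.1 :=
  Function.bijective_iff_has_inverse.2 ⟨e.inv.1,
    fun x => congrArg (fun f : M ⟶ M => f.1 x) e.hom_inv_id,
    fun x => congrArg (fun f : N ⟶ N => f.1 x) e.inv_hom_id⟩

section

variable (F : FirmMod R ⥤ Comod A C) [PreservesFiniteColimits F]

/-- The action of `R` on `F(R)` through left multiplications. -/
def selfAction : R →ₙ+* End (F.obj (FirmMod.self R)) :=
  haveI := FirmMod.additive_of_preservesFiniteColimits F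
  { toFun := fun r => F.map (FirmMod.lmul R r)
    map_mul' := fun r s => by
      rw [End.mul_def, ← F.map_comp]
      -- `lmul R r` is the orbit map of `r`, and `op s • r` is `r * s`. The product in `End` is
      -- composition of functions, which matches the order in `lmul R s ≫ lmul R r`.
      exact congrArg F.map (FirmMod.orbit_smul (FirmMod.self R) s r)
    map_zero' := by
      have h : FirmMod.lmul R 0 = 0 :=
        ObjectProperty.hom_ext _ (RMod.Hom.ext (AddMonoidHom.ext fun (s : R) => zero_mul s))
      rw [h, F.map_zero]
    map_add' := fun r s =>
      (congrArg F.map (FirmMod.orbit_add (FirmMod.self R) r s)).trans F.map_add }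

/-- The bicomodule `F(R)`. -/
abbrev selfBicomod : Bicomod R A C := Bicomod.ofHom (F.obj (FirmMod.self R)) (selfAction F)

/-- The map `M ⊗_R F(R) → F(M)`, `m ⊗ u ↦ F(r ↦ m r)(u)`. -/
def tensorSelfHom (M : FirmMod R) : (selfBicomod F).tensorObj M.obj ⟶ F.obj M :=
  haveI := FirmMod.additive_of_preservesFiniteColimits F
  Bicomod.tensorLift (B := selfBicomod F)
    (AddMonoidHom.mk' (fun m => F.map (FirmMod.orbit M m)) fun m m' =>
      (congrArg F.map (FirmMod.orbit_add M m m')).trans F.map_add)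
    fun r m => (congrArg F.map (FirmMod.orbit_smul M r m)).trans (F.map_comp _ _)

variable [∀ J : Type u, PreservesColimitsOfShape (Discrete J) F]

/-- If `F` is right exact and preserves direct sums, then `M ⊗_R F(R) → F(M)` is an
isomorphism. -/
theorem isIso_tensorSelfHom (M : FirmMod R) : IsIso (tensorSelfHom F M) := by
  -- The inverse is induced by the balanced family of maps `u ↦ m ⊗ u`; both composites are
  -- identities by the uniqueness halves of the two universal properties.
  obtain ⟨k, hk⟩ := FirmMod.exists_map_desc M F ((selfBicomod F).pure M.obj)
    (Bicomod.pure_add M.obj) (Bicomod.pure_smul M.obj)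
  refine ⟨k, Bicomod.tensorObj_hom_ext fun m => ?_, FirmMod.map_orbit_hom_ext M F fun m => ?_⟩
  · exact (hk m).trans (Category.comp_id _).symm
  · rw [← Category.assoc, hk, Category.comp_id]
    rfl

/-- The isomorphism `M ⊗_R F(R) ≅ F(M)` for a right exact functor `F` that preserves
direct sums. -/
noncomputable def tensorSelfIso (M : FirmMod R) : (selfBicomod F).tensorObj M.obj ≅ F.obj M :=
  haveI := isIso_tensorSelfHom F M
  asIso (tensorSelfHom F M)

/-- A right exact functor that preserves direct sums is `- ⊗_R F(R)`. -/
noncomputable def isoTensorSelf : F ≅ (selfBicomod F).tensorFirm :=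
  (NatIso.ofComponents ((tensorSelfIso F)) fun {M N} f =>
    Bicomod.tensorObj_hom_ext fun m => by
      change F.map (FirmMod.orbit N (f.hom.toAddHom m)) = F.map (FirmMod.orbit M m) ≫ F.map f
      rw [← F.map_comp, FirmMod.orbit_comp]).symm

/-- At `M = R` the comparison map sends `r ⊗ u` to `F(lmul r)(u) = r u`, so it is the multiplication
`R ⊗_R F(R) → F(R)`, already known to be an isomorphism. -/
theorem isFirm_selfBicomod : (selfBicomod F).IsFirm := by
  have h := Comod.bijective_of_iso (tensorSelfIso F (FirmMod.self R))
  have heq : (tensorSelfHom F (FirmMod.self R)).1.toAddMonoidHom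
      = mulLeft R (selfBicomod F).carrier := Tens.hom_ext fun _ _ => rfl
  exact (congrArg (fun f : Tens R R (selfBicomod F).carrier →+ (selfBicomod F).carrier =>
    Function.Bijective f) heq).mp h

end

/-- The functor `- ⊗_R Σ` on firm modules is left adjoint to `Hom^C(Σ, -) ⊗_R R`. -/
noncomputable def Bicomod.tensorFirmAdj (B : Bicomod R A C) : B.tensorFirm ⊣ B.homFirm :=
  firmificationAdj.comp B.tensorAdj

end FirmCoring

/-! ### The main theorem -/

open FirmCoring
theorem theorem3p2 {R : Type u} [NonUnitalRing R] [IsFirmRing R]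
    {A : Type u} [Ring A] {C : Type u} [AddCommGroup C] [Module A C] [Module Aᵐᵒᵖ C]
    [SMulCommClass A Aᵐᵒᵖ C] [Coring A C] (F : FirmMod R ⥤ Comod A C) :
    -- right adjoint; right exact and direct sums; tensor functor
    List.TFAE
      [ F.IsLeftAdjoint,
        PreservesFiniteColimits F ∧ ∀ J : Type u, PreservesColimitsOfShape (Discrete J) F,
        ∃ B : Bicomod R A C, B.IsFirm ∧ Nonempty (F ≅ B.tensorFirm) ] ∧
    (F.IsLeftAdjoint →
      -- `F(R)`, with `R` acting through `F`, is a bicomodule that represents `F`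
      (∃ j : R →ₙ+* End (F.obj (FirmMod.self R)),
        (∀ r : R, j r = F.map (FirmMod.lmul R r)) ∧
        (Bicomod.ofHom (F.obj (FirmMod.self R)) j).IsFirm ∧
        Nonempty (F ≅ (Bicomod.ofHom (F.obj (FirmMod.self R)) j).tensorFirm)) ∧
      -- right adjoint, ring morphism and canonical map, for every bicomodule representing `F`
      ∀ B : Bicomod R A C, B.IsFirm → Nonempty (F ≅ B.tensorFirm) →
        (Nonempty (F ⊣ B.homFirm) ∧
          ∀ G : Comod A C ⥤ FirmMod R, Nonempty (F ⊣ G) → Nonempty (G ≅ B.homFirm)) ∧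
        (∃ j : R →ₙ+* End B.toComod, ∀ (r : R) (u : B.carrier), (j r).1 u = r • u) ∧
        (∃ can : B.homMod ⋙ B.tensor ⟶ cofree A C,
          ∀ (M : ModuleCat.{u} Aᵐᵒᵖ) (f : B.carrier →ₗ[Aᵐᵒᵖ] M) (u : B.carrier),
            (can.app M).1 (Tens.tmul R (M := (B.homMod.obj M).carrier) f u) =
              tensorCoring C f (B.coact u))) := by
  -- The explicit bicomodule `F(R)` serves twice: as the witness for (ii) ⇒ (iii), and for the later
  -- claim about `F(R)` itself.
  have key (h : PreservesFiniteColimits F ∧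
      ∀ J : Type u, PreservesColimitsOfShape (Discrete J) F) :
      ∃ j : R →ₙ+* End (F.obj (FirmMod.self R)),
        (∀ r : R, j r = F.map (FirmMod.lmul R r)) ∧
        (Bicomod.ofHom (F.obj (FirmMod.self R)) j).IsFirm ∧
        Nonempty (F ≅ (Bicomod.ofHom (F.obj (FirmMod.self R)) j).tensorFirm) := by
    obtain ⟨_, _⟩ := h
    exact ⟨selfAction F, fun _ => rfl, isFirm_selfBicomod F, ⟨isoTensorSelf F⟩⟩
  have preserves (h : F.IsLeftAdjoint) : PreservesFiniteColimits F ∧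
      ∀ J : Type u, PreservesColimitsOfShape (Discrete J) F := by
    have := (Adjunction.ofIsLeftAdjoint F).leftAdjoint_preservesColimits
    exact ⟨inferInstance, fun _ => inferInstance⟩
  refine ⟨?_, fun hF => ⟨key (preserves hF), fun B _ ⟨e⟩ => ?_⟩⟩
  · tfae_have 1 → 2 := preserves
    tfae_have 2 → 3 := fun h => by
      obtain ⟨j, -, hj⟩ := key h
      exact ⟨_, hj⟩
    tfae_have 3 → 1 := fun ⟨B, _, ⟨e⟩⟩ => (B.tensorFirmAdj.ofNatIsoLeft e.symm).isLeftAdjoint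
    tfae_finish
  · let adj : F ⊣ B.homFirm := B.tensorFirmAdj.ofNatIsoLeft e.symm
    exact ⟨⟨⟨adj⟩, fun G ⟨adj'⟩ => ⟨adj'.rightAdjointUniq adj⟩⟩,
      ⟨B.lmulHom, fun _ _ => rfl⟩, ⟨B.can, fun _ _ _ => rfl⟩⟩
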